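/- Let $\Gamma$ be a compact, connected, finite metric graph with vertex set $\mathcal V$ and edge set $\mathcal E$, each edge $e$ being identified with an interval $(0,l_e)$, $0<l_e<\infty$ (loops and multiple edges are allowed). Let $L^2(\Gamma)=\bigoplus_{e}L^2(0,l_e)$ (complex-valued functions), and let $\|f\|_{L^\infty(\Gamma)}$ be the largest of the essential suprema of $|f_e|$, $e\in\mathcal E$. Let $V=(v_e)_{e\in\mathcal E}$ be a real potential with $v_e\in (C^\infty\cap L^\infty)(0,l_e)$ and let $\sigma=(\sigma_v)_{v\in\mathcal V}\in\mathbb R^{\mathcal V}$. Let $H^V_\sigma$ be the Schrödinger operator $(H^V_\sigma f)_e=-f_e''+v_ef_e$ on $L^2(\Gamma)$ whose domain consists of all $f$ with $f_e\in H^2(0,l_e)$ for every $e$ that are continuous across the vertices and satisfy $\sum_{e\sim v}\partial_vf_e(v)=\sigma_vf(v)$ at every vertex $v$, where $\partial_v f_e(v)$ is the inward derivative at the end of $e$ attached to $v$ (a loop contributes both of its ends). Then there is a constant $C>0$ such that for every $\tau\in[0,1]$, every eigenfunction $f$ of $H^{V}_{\tau\sigma}$ with $\|f\|_{L^2(\Gamma)}=1$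 satisfies $\|f\|_{L^\infty(\Gamma)}\le C$, and every eigenfunction $f$ of $H^{\tau V}_{\tau\sigma}$ with $\|f\|_{L^2(\Gamma)}=1$ satisfies $\|f\|_{L^\infty(\Gamma)}\le C$. In particular, for any choice of orthonormal eigenfunctions $f_n^{\tau\sigma,V}$ and $f_n^{\tau\sigma,\tau V}$ belonging to the $n$-th eigenvalues of these operators (counted with multiplicity), one has $\|f_n^{\tau\sigma,V}\|_{L^\infty(\Gamma)}\le C$ and $\|f_n^{\tau\sigma,\tau V}\|_{L^\infty(\Gamma)}\le C$ for all $n\in\mathbb N$ and all $\tau\in[0,1]$. -/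

import Mathlib

open MeasureTheory Set
open scoped ContDiff ENNReal

noncomputable section

namespace QuantumGraph

/-- A compact, connected, finite metric graph with vertex set `V` and edge set `E` (both finite where
it is used). The edge `e` is the interval `(0, len e)`; its end `x = 0` is glued to the vertex
`src e` and its end `x = len e` to the vertex `tgt e`. Loops and multiple edges are allowed; the
choice of an orientation only fixes the coordinate on the edge. -/
structure MetricGraph (V E : Type*) where
  src : E → V
  tgt : E → V
  len : E → ℝ
  len_pos : ∀ e, 0 < len e
  connected : (SimpleGraph.fromRel (fun v w : V => ∃ e, src e = v ∧ tgt e = w)).Connected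

/-- The complex Hilbert space `L²(0, l)`. -/
abbrev EdgeL2 (l : ℝ) : Type := Lp ℂ 2 (volume.restrict (Ioo (0 : ℝ) l))

/-- `g` is the weak derivative of `f` on `(0, l)`. -/
def HasWeakDeriv {l : ℝ} (f g : EdgeL2 l) : Prop :=
  ∀ φ : ℝ → ℝ, ContDiff ℝ ∞ φ → HasCompactSupport φ → tsupport φ ⊆ Ioo 0 l →
    ∫ x in Ioo 0 l, deriv φ x • f x = - ∫ x in Ioo 0 l, φ x • g x

/-- Membership in the Sobolev space `H¹(0, l)`. -/
def MemH1 {l : ℝ} (f : EdgeL2 l) : Prop := ∃ g : EdgeL2 l, HasWeakDeriv f g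

open Classical in
/-- The weak derivative of `f ∈ H¹(0, l)` (and `0` if `f` is not in `H¹(0, l)`). -/
def weakDeriv {l : ℝ} (f : EdgeL2 l) : EdgeL2 l :=
  if h : MemH1 f then h.choose else 0

/-- Membership in the Sobolev space `H²(0, l)`. -/
def MemH2 {l : ℝ} (f : EdgeL2 l) : Prop := MemH1 f ∧ MemH1 (weakDeriv f)

/-- The (unique) representative of `f` that is continuous on `[0, l]` takes the value `c` at `x`.
Every `f ∈ H¹(0, l)` has such a representative. -/
def HasValueAt {l : ℝ} (f : EdgeL2 l) (x : ℝ) (c : ℂ) : Prop :=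
  ∃ u : ℝ → ℂ, ContinuousOn u (Icc 0 l) ∧ f =ᵐ[volume.restrict (Ioo 0 l)] u ∧ u x = c

lemma integrable_smul_of_compact {l : ℝ} (f : EdgeL2 l) {φ : ℝ → ℝ} (hφ : Continuous φ)
    (hc : HasCompactSupport φ) :
    Integrable (fun x => φ x • f x) (volume.restrict (Ioo 0 l)) := by
  have hf : Integrable f (volume.restrict (Ioo 0 l)) := (Lp.memLp f).integrable (by norm_num)
  obtain ⟨M, hM⟩ := hc.exists_bound_of_continuous hφ
  exact hf.bdd_smul M hφ.aestronglyMeasurable (Filter.Eventually.of_forall hM)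

lemma HasWeakDeriv.add {l : ℝ} {f g f' g' : EdgeL2 l} (h : HasWeakDeriv f g)
    (h' : HasWeakDeriv f' g') : HasWeakDeriv (f + f') (g + g') := by
  intro φ h1 h2 h3
  have hd : Continuous (deriv φ) := h1.continuous_deriv (by simp)
  have e1 : ∫ x in Ioo 0 l, deriv φ x • (f + f' : EdgeL2 l) x
      = ∫ x in Ioo 0 l, (deriv φ x • f x + deriv φ x • f' x) := by
    apply integral_congr_ae
    filter_upwards [Lp.coeFn_add f f'] with x hx
    rw [hx, Pi.add_apply, smul_add]
  have e2 : ∫ x in Ioo 0 l, φ x • (g + g' : EdgeL2 l) x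
      = ∫ x in Ioo 0 l, (φ x • g x + φ x • g' x) := by
    apply integral_congr_ae
    filter_upwards [Lp.coeFn_add g g'] with x hx
    rw [hx, Pi.add_apply, smul_add]
  rw [e1, e2, integral_add (integrable_smul_of_compact f hd h2.deriv)
    (integrable_smul_of_compact f' hd h2.deriv),
    integral_add (integrable_smul_of_compact g h1.continuous h2)
    (integrable_smul_of_compact g' h1.continuous h2), h φ h1 h2 h3, h' φ h1 h2 h3, neg_add]

lemma HasWeakDeriv.smul {l : ℝ} {f g : EdgeL2 l} (c : ℂ) (h : HasWeakDeriv f g) :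
    HasWeakDeriv (c • f) (c • g) := by
  intro φ h1 h2 h3
  have e1 : ∫ x in Ioo 0 l, deriv φ x • (c • f : EdgeL2 l) x
      = ∫ x in Ioo 0 l, c • (deriv φ x • f x) := by
    apply integral_congr_ae
    filter_upwards [Lp.coeFn_smul c f] with x hx
    rw [hx, Pi.smul_apply, smul_comm]
  have e2 : ∫ x in Ioo 0 l, φ x • (c • g : EdgeL2 l) x
      = ∫ x in Ioo 0 l, c • (φ x • g x) := by
    apply integral_congr_ae
    filter_upwards [Lp.coeFn_smul c g] with x hx
    rw [hx, Pi.smul_apply, smul_comm]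
  rw [e1, e2, integral_smul, integral_smul, h φ h1 h2 h3, smul_neg]

lemma HasWeakDeriv.unique {l : ℝ} {f g g' : EdgeL2 l} (h : HasWeakDeriv f g)
    (h' : HasWeakDeriv f g') : g = g' := by
  have hg : Integrable g (volume.restrict (Ioo 0 l)) := (Lp.memLp g).integrable (by norm_num)
  have hg' : Integrable g' (volume.restrict (Ioo 0 l)) := (Lp.memLp g').integrable (by norm_num)
  have key := isOpen_Ioo.ae_eq_zero_of_integral_contDiff_smul_eq_zero
    (U := Ioo (0 : ℝ) l) (μ := volume.restrict (Ioo (0 : ℝ) l)) (f := fun x => g x - g' x)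
    ((hg.sub hg').locallyIntegrable.locallyIntegrableOn _) (by
      intro φ h1 h2 h3
      simp only [smul_sub]
      rw [integral_sub (integrable_smul_of_compact g h1.continuous h2)
        (integrable_smul_of_compact g' h1.continuous h2), sub_eq_zero]
      exact neg_injective ((h φ h1 h2 h3).symm.trans (h' φ h1 h2 h3)))
  apply Lp.ext
  filter_upwards [key, ae_restrict_mem measurableSet_Ioo] with x hx hm
  exact sub_eq_zero.1 (hx hm)

lemma hasWeakDeriv_weakDeriv {l : ℝ} {f : EdgeL2 l} (h : MemH1 f) :
    HasWeakDeriv f (weakDeriv f) := by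
  rw [weakDeriv, dif_pos h]
  exact h.choose_spec

lemma HasWeakDeriv.weakDeriv_eq {l : ℝ} {f g : EdgeL2 l} (h : HasWeakDeriv f g) :
    weakDeriv f = g :=
  (hasWeakDeriv_weakDeriv ⟨g, h⟩).unique h

lemma MemH1.add {l : ℝ} {f g : EdgeL2 l} (hf : MemH1 f) (hg : MemH1 g) : MemH1 (f + g) :=
  ⟨_, hf.choose_spec.add hg.choose_spec⟩

lemma MemH1.smul {l : ℝ} {f : EdgeL2 l} (c : ℂ) (hf : MemH1 f) : MemH1 (c • f) :=
  ⟨_, hf.choose_spec.smul c⟩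

lemma weakDeriv_add {l : ℝ} {f g : EdgeL2 l} (hf : MemH1 f) (hg : MemH1 g) :
    weakDeriv (f + g) = weakDeriv f + weakDeriv g :=
  ((hasWeakDeriv_weakDeriv hf).add (hasWeakDeriv_weakDeriv hg)).weakDeriv_eq

lemma weakDeriv_smul {l : ℝ} {f : EdgeL2 l} (c : ℂ) (hf : MemH1 f) :
    weakDeriv (c • f) = c • weakDeriv f :=
  ((hasWeakDeriv_weakDeriv hf).smul c).weakDeriv_eq

lemma MemH2.add {l : ℝ} {f g : EdgeL2 l} (hf : MemH2 f) (hg : MemH2 g) : MemH2 (f + g) :=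
  ⟨hf.1.add hg.1, by rw [weakDeriv_add hf.1 hg.1]; exact hf.2.add hg.2⟩

lemma MemH2.smul {l : ℝ} {f : EdgeL2 l} (c : ℂ) (hf : MemH2 f) : MemH2 (c • f) :=
  ⟨hf.1.smul c, by rw [weakDeriv_smul c hf.1]; exact hf.2.smul c⟩

lemma HasValueAt.add {l x : ℝ} {f g : EdgeL2 l} {a b : ℂ} (hf : HasValueAt f x a)
    (hg : HasValueAt g x b) : HasValueAt (f + g) x (a + b) := by
  obtain ⟨u, hu, hfu, rfl⟩ := hf
  obtain ⟨w, hw, hgw, rfl⟩ := hg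
  exact ⟨u + w, hu.add hw, (Lp.coeFn_add f g).trans (hfu.add hgw), rfl⟩

lemma HasValueAt.smul {l x : ℝ} {f : EdgeL2 l} {a : ℂ} (c : ℂ) (hf : HasValueAt f x a) :
    HasValueAt (c • f) x (c * a) := by
  obtain ⟨u, hu, hfu, rfl⟩ := hf
  exact ⟨c • u, hu.const_smul c, (Lp.coeFn_smul c f).trans (hfu.const_smul c), rfl⟩

lemma hasWeakDeriv_zero {l : ℝ} : HasWeakDeriv (0 : EdgeL2 l) 0 := by
  intro φ _ _ _
  have e : ∀ ψ : ℝ → ℝ, ∫ x in Ioo 0 l, ψ x • (0 : EdgeL2 l) x = 0 := by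
    intro ψ
    rw [integral_congr_ae (g := fun _ => (0 : ℂ)), integral_zero]
    filter_upwards [Lp.coeFn_zero ℂ 2 (volume.restrict (Ioo (0 : ℝ) l))] with x hx
    rw [hx, Pi.zero_apply, smul_zero]
  rw [e, e, neg_zero]

lemma memH2_zero {l : ℝ} : MemH2 (0 : EdgeL2 l) :=
  ⟨⟨0, hasWeakDeriv_zero⟩, by rw [hasWeakDeriv_zero.weakDeriv_eq]; exact ⟨0, hasWeakDeriv_zero⟩⟩

lemma hasValueAt_zero {l x : ℝ} : HasValueAt (0 : EdgeL2 l) x 0 :=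
  ⟨0, continuousOn_const, Lp.coeFn_zero _ _ _, rfl⟩

section Graph

variable {V E : Type*}

/-- `L²(Γ) = ⨁ₑ L²(0, lₑ)`, with its Hilbert space norm. -/
abbrev L2 (G : MetricGraph V E) : Type _ := PiLp 2 (fun e : E => EdgeL2 (G.len e))

/-- The norm of `L^∞(Γ)`: the largest of the essential suprema over the edges. -/
def linftyNorm (G : MetricGraph V E) (f : L2 G) : ℝ≥0∞ :=
  ⨆ e, eLpNorm (f e) ∞ (volume.restrict (Ioo 0 (G.len e)))

/-- `f` is continuous across vertices: for each edge incident to `v`, the boundary value of `f` at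
the end of the edge that is glued to `v` is `F v`. -/
def HasVertexValues (G : MetricGraph V E) (f : L2 G) (F : V → ℂ) : Prop :=
  ∀ e, HasValueAt (f e) 0 (F (G.src e)) ∧ HasValueAt (f e) (G.len e) (F (G.tgt e))

/-- A real potential that is smooth and bounded on every (open) edge. The values of `val e` outside
`(0, len e)` play no role. -/
structure Potential (G : MetricGraph V E) where
  val : E → ℝ → ℝ
  smooth : ∀ e, ContDiffOn ℝ ∞ (val e) (Ioo 0 (G.len e))
  bounded : ∀ e, ∃ M : ℝ, ∀ x ∈ Ioo 0 (G.len e), |val e x| ≤ M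

/-- The potential `τ V`. -/
instance (G : MetricGraph V E) : SMul ℝ (Potential G) where
  smul τ U :=
    { val := fun e x => τ * U.val e x
      smooth := fun e => contDiffOn_const.mul (U.smooth e)
      bounded := fun e => by
        obtain ⟨M, hM⟩ := U.bounded e
        refine ⟨|τ| * M, fun x hx => ?_⟩
        rw [abs_mul]
        exact mul_le_mul_of_nonneg_left (hM x hx) (abs_nonneg τ) }

lemma Potential.memLp_mul {G : MetricGraph V E} (U : Potential G) (e : E)
    (f : EdgeL2 (G.len e)) :
    MemLp (fun x => (U.val e x : ℂ) * f x) 2 (volume.restrict (Ioo 0 (G.len e))) := by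
  obtain ⟨M, hM⟩ := U.bounded e
  have hm : AEStronglyMeasurable (fun x => (U.val e x : ℂ))
      (volume.restrict (Ioo 0 (G.len e))) :=
    (Complex.continuous_ofReal.comp_continuousOn (U.smooth e).continuousOn).aestronglyMeasurable
      measurableSet_Ioo
  refine (Lp.memLp f).of_le_mul (c := M) (hm.mul (Lp.aestronglyMeasurable f)) ?_
  filter_upwards [ae_restrict_mem measurableSet_Ioo] with x hx
  rw [norm_mul, Complex.norm_real, Real.norm_eq_abs]
  exact mul_le_mul_of_nonneg_right (hM x hx) (norm_nonneg _)

/-- Multiplication by the potential on the edge `e`. -/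
def Potential.mulEdge {G : MetricGraph V E} (U : Potential G) (e : E) :
    EdgeL2 (G.len e) →ₗ[ℂ] EdgeL2 (G.len e) where
  toFun f := (U.memLp_mul e f).toLp
  map_add' f g := by
    apply Lp.ext
    filter_upwards [(U.memLp_mul e (f + g)).coeFn_toLp, (U.memLp_mul e f).coeFn_toLp,
      (U.memLp_mul e g).coeFn_toLp, Lp.coeFn_add f g,
      Lp.coeFn_add (U.memLp_mul e f).toLp (U.memLp_mul e g).toLp] with x h1 h2 h3 h4 h5
    rw [h1, h5, Pi.add_apply, h2, h3, h4, Pi.add_apply, mul_add]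
  map_smul' c f := by
    apply Lp.ext
    filter_upwards [(U.memLp_mul e (c • f)).coeFn_toLp, (U.memLp_mul e f).coeFn_toLp,
      Lp.coeFn_smul c f, Lp.coeFn_smul c (U.memLp_mul e f).toLp] with x h1 h2 h3 h4
    rw [RingHom.id_apply, h1, h4, Pi.smul_apply, h2, h3, Pi.smul_apply, smul_eq_mul, smul_eq_mul]
    ring

variable [Fintype E]

open Classical in
/-- For a function with edgewise derivatives `a e` at `x = 0` and `b e` at `x = len e`, the sum over
all edge ends at `v` of the inward derivatives (a loop contributes both of its ends). -/
def inwardDerivSum (G : MetricGraph V E) (a b : E → ℂ) (v : V) : ℂ :=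
  ∑ e, ((if G.src e = v then a e else 0) + (if G.tgt e = v then - b e else 0))

lemma inwardDerivSum_add (G : MetricGraph V E) (a b a' b' : E → ℂ) (v : V) :
    inwardDerivSum G (a + a') (b + b') v = inwardDerivSum G a b v + inwardDerivSum G a' b' v := by
  rw [inwardDerivSum, inwardDerivSum, inwardDerivSum, ← Finset.sum_add_distrib]
  refine Finset.sum_congr rfl fun e _ => ?_
  by_cases h1 : G.src e = v <;> by_cases h2 : G.tgt e = v <;> simp [h1, h2] <;> ring

lemma inwardDerivSum_smul (G : MetricGraph V E) (c : ℂ) (a b : E → ℂ) (v : V) :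
    inwardDerivSum G (c • a) (c • b) v = c * inwardDerivSum G a b v := by
  rw [inwardDerivSum, inwardDerivSum, Finset.mul_sum]
  refine Finset.sum_congr rfl fun e _ => ?_
  by_cases h1 : G.src e = v <;> by_cases h2 : G.tgt e = v <;> simp [h1, h2] <;> ring

/-- The domain `D_σ` of the Laplacian with `δ`-coupling of strengths `σ`: functions in `H²` on every
edge, continuous across vertices, with `∑_{e ∼ v} ∂_v f_e(v) = σ_v f(v)` at every vertex `v`. -/
def deltaDomain (G : MetricGraph V E) (σ : V → ℝ) : Submodule ℂ (L2 G) where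
  carrier := {f | (∀ e, MemH2 (f e)) ∧ ∃ F : V → ℂ, HasVertexValues G f F ∧
    ∃ a b : E → ℂ, (∀ e, HasValueAt (weakDeriv (f e)) 0 (a e) ∧
        HasValueAt (weakDeriv (f e)) (G.len e) (b e)) ∧
      ∀ v, inwardDerivSum G a b v = (σ v : ℂ) * F v}
  zero_mem' := by
    refine ⟨fun e => memH2_zero, 0, fun e => ⟨hasValueAt_zero, hasValueAt_zero⟩, 0, 0,
      fun e => ?_, fun v => ?_⟩
    · have : weakDeriv ((0 : L2 G) e) = 0 := hasWeakDeriv_zero.weakDeriv_eq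
      rw [this]
      exact ⟨hasValueAt_zero, hasValueAt_zero⟩
    · simp [inwardDerivSum]
  add_mem' := by
    rintro f g ⟨hf, F, hF, a, b, hab, hs⟩ ⟨hg, F', hF', a', b', hab', hs'⟩
    refine ⟨fun e => (hf e).add (hg e), F + F', fun e =>
      ⟨(hF e).1.add (hF' e).1, (hF e).2.add (hF' e).2⟩, a + a', b + b', fun e => ?_, fun v => ?_⟩
    · rw [PiLp.add_apply, weakDeriv_add (hf e).1 (hg e).1]
      exact ⟨(hab e).1.add (hab' e).1, (hab e).2.add (hab' e).2⟩
    · rw [inwardDerivSum_add, hs, hs', Pi.add_apply, mul_add]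
  smul_mem' := by
    rintro c f ⟨hf, F, hF, a, b, hab, hs⟩
    refine ⟨fun e => (hf e).smul c, c • F, fun e =>
      ⟨(hF e).1.smul c, (hF e).2.smul c⟩, c • a, c • b, fun e => ?_, fun v => ?_⟩
    · rw [PiLp.smul_apply, weakDeriv_smul c (hf e).1]
      exact ⟨(hab e).1.smul c, (hab e).2.smul c⟩
    · rw [inwardDerivSum_smul, hs, Pi.smul_apply, smul_eq_mul]; ring

/-- The Schrödinger operator `H^V_σ = (-Δ + V, D_σ)`, an unbounded operator on `L²(Γ)`; it acts on
the edge `e` by `f_e ↦ -f_e'' + v_e f_e`. -/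
def schrodinger (G : MetricGraph V E) (U : Potential G) (σ : V → ℝ) : L2 G →ₗ.[ℂ] L2 G where
  domain := deltaDomain G σ
  toFun :=
    { toFun := fun f => WithLp.toLp 2 fun e =>
        - weakDeriv (weakDeriv ((f : L2 G) e)) + U.mulEdge e ((f : L2 G) e)
      map_add' := by
        rintro ⟨f, hf⟩ ⟨g, hg⟩
        ext1 e
        change - weakDeriv (weakDeriv (f e + g e)) + U.mulEdge e (f e + g e) =
          (- weakDeriv (weakDeriv (f e)) + U.mulEdge e (f e)) +
          (- weakDeriv (weakDeriv (g e)) + U.mulEdge e (g e))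
        rw [weakDeriv_add (hf.1 e).1 (hg.1 e).1, weakDeriv_add (hf.1 e).2 (hg.1 e).2, map_add]
        abel
      map_smul' := by
        rintro c ⟨f, hf⟩
        ext1 e
        change - weakDeriv (weakDeriv (c • f e)) + U.mulEdge e (c • f e) =
          c • (- weakDeriv (weakDeriv (f e)) + U.mulEdge e (f e))
        rw [weakDeriv_smul c (hf.1 e).1, weakDeriv_smul c (hf.1 e).2, map_smul, smul_add,
          smul_neg] }

/-- `f` is an eigenfunction of `H` for the eigenvalue `lam`, normalized in `L²(Γ)`. -/
def IsNormalizedEigenfunction {G : MetricGraph V E} (H : L2 G →ₗ.[ℂ] L2 G) (lam : ℝ)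
    (f : L2 G) : Prop :=
  ‖f‖ = 1 ∧ ∃ hf : f ∈ H.domain, H ⟨f, hf⟩ = (lam : ℂ) • f

end Graph

end QuantumGraph

end

/-!
Write `W` for the sum over the edges of `∫ |f_e'|²`, where `f` is a normalized eigenfunction for the
eigenvalue `lam`. All potentials that occur are bounded by one constant `M`, and all coupling
strengths have total size at most one constant `S`; the bound depends on these and on the graph only.

The elements of the domain are `L²` classes with weak derivatives. The lemma of du Bois-Reymond turns
the eigenvalue equation into the classical equation `u'' = (q - lam) u` on each open edge, with `u`
and `u'` continuous up to the ends (`exists_isEdgeSolution`).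

Testing the equation with `f` gives `W ≤ M + lam - ∑ σ_v |f(v)|²`. By the trace inequality
(`IsEdgeSolution.norm_sq_le`) the vertex terms are at most `W / 2` plus a constant, so that
`W ≤ 2 (lam + D)` with `D` uniform. In particular `lam ≥ -D`.

Put `μ = max lam 1`. The pointwise energy `|u'|² + μ |u|²` has logarithmic derivative at most
`K = M + 1 + D`, because `μ ≥ 1` and `q - lam + μ` is bounded by `K`. By Grönwall its value at any
point is at most `exp (K l) / l` times its integral over the edge
(`IsEdgeSolution.mul_norm_sq_le`). That integral is at most `W + μ ≤ μ (3 + 2 D)`, and dividing by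
`μ` leaves a bound for `|u|²` in which `lam` no longer occurs (`exists_linftyNorm_le`).
-/

namespace QuantumGraph

/-! ### Weak derivatives and classical derivatives -/

/-- A test function with mean zero is the derivative of a test function. -/
lemma exists_contDiff_primitive {l : ℝ} (hl : 0 < l) {ψ : ℝ → ℝ} (hψ : ContDiff ℝ ∞ ψ)
    (hc : HasCompactSupport ψ) (hs : tsupport ψ ⊆ Ioo 0 l) (h0 : ∫ x in Ioo 0 l, ψ x = 0) :
    ∃ φ : ℝ → ℝ, ContDiff ℝ ∞ φ ∧ HasCompactSupport φ ∧ tsupport φ ⊆ Ioo 0 l ∧ deriv φ = ψ := by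
  obtain ⟨a, b, ha, hb, hab⟩ : ∃ a b : ℝ, 0 < a ∧ b < l ∧ tsupport ψ ⊆ Icc a b := by
    -- The midpoint is added so that the compact set is nonempty.
    have hK : IsCompact (insert (l / 2) (tsupport ψ)) := IsCompact.insert hc _
    have hsub : insert (l / 2) (tsupport ψ) ⊆ Ioo 0 l :=
      insert_subset ⟨by linarith, by linarith⟩ hs
    obtain ⟨a, ha⟩ := hK.exists_isLeast ⟨_, mem_insert _ _⟩
    obtain ⟨b, hb⟩ := hK.exists_isGreatest ⟨_, mem_insert _ _⟩
    exact ⟨a, b, (hsub ha.1).1, (hsub hb.1).2,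
      fun x hx => ⟨ha.2 (mem_insert_of_mem _ hx), hb.2 (mem_insert_of_mem _ hx)⟩⟩
  have hzero : ∀ t, t ∉ Icc a b → ψ t = 0 := fun t ht => image_eq_zero_of_notMem_tsupport
    fun h => ht (hab h)
  have hd : ∀ x, HasDerivAt (fun x => ∫ t in (0 : ℝ)..x, ψ t) (ψ x) x := fun x =>
    (hψ.continuous.integral_hasStrictDerivAt 0 x).hasDerivAt
  have hderiv : deriv (fun x => ∫ t in (0 : ℝ)..x, ψ t) = ψ := funext fun x => (hd x).deriv
  have hvanish : ∀ x, x ∉ Icc a b → ∫ t in (0 : ℝ)..x, ψ t = 0 := by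
    intro x hx
    rcases lt_or_ge x a with h | h
    · apply intervalIntegral.integral_zero_ae
      refine Filter.Eventually.of_forall fun t ht => hzero t fun ht' => ?_
      exact (ht.2.trans_lt (max_lt ha h)).not_ge ht'.1
    · have hxb : b < x := by
        by_contra hb'
        exact hx ⟨h, not_lt.1 hb'⟩
      have h1 : ∫ t in (0 : ℝ)..l, ψ t = 0 := by
        rwa [intervalIntegral.integral_of_le hl.le, integral_Ioc_eq_integral_Ioo]
      have h2 : ∫ t in l..x, ψ t = 0 := by
        apply intervalIntegral.integral_zero_ae
        refine Filter.Eventually.of_forall fun t ht => hzero t fun ht' => ?_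
        exact ((lt_min hb hxb).trans ht.1).not_ge ht'.2
      rw [← intervalIntegral.integral_add_adjacent_intervals
        (hψ.continuous.intervalIntegrable 0 l) (hψ.continuous.intervalIntegrable l x), h1, h2,
        add_zero]
  refine ⟨fun x => ∫ t in (0 : ℝ)..x, ψ t, contDiff_infty_iff_deriv.2
    ⟨fun x => (hd x).differentiableAt, by rwa [hderiv]⟩,
    HasCompactSupport.intro isCompact_Icc hvanish, ?_, hderiv⟩
  refine (closure_minimal (fun x hx => ?_) isClosed_Icc).trans (Icc_subset_Ioo ha hb)
  by_contra hx'
  exact hx (hvanish x hx')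

lemma integrable_smul_of_hasCompactSupport {l : ℝ} {h : ℝ → ℂ} (hh : IntegrableOn h (Ioo 0 l))
    {φ : ℝ → ℝ} (hφ : Continuous φ) (hc : HasCompactSupport φ) :
    IntegrableOn (fun x => φ x • h x) (Ioo 0 l) := by
  obtain ⟨M, hM⟩ := hc.exists_bound_of_continuous hφ
  exact (show Integrable h (volume.restrict (Ioo 0 l)) from hh).bdd_smul M
    hφ.aestronglyMeasurable (Filter.Eventually.of_forall hM)

/-- The lemma of du Bois-Reymond: an integrable function whose distributional derivative
vanishes is almost everywhere constant. -/
lemma ae_eq_const_of_integral_deriv_smul_eq_zero {l : ℝ} (hl : 0 < l) {h : ℝ → ℂ}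
    (hh : IntegrableOn h (Ioo 0 l))
    (hφ : ∀ φ : ℝ → ℝ, ContDiff ℝ ∞ φ → HasCompactSupport φ → tsupport φ ⊆ Ioo 0 l →
      ∫ x in Ioo 0 l, deriv φ x • h x = 0) :
    ∃ c : ℂ, h =ᵐ[volume.restrict (Ioo 0 l)] fun _ => c := by
  obtain ⟨η, hη, hηc, hηs, hη1⟩ : ∃ η : ℝ → ℝ, ContDiff ℝ ∞ η ∧ HasCompactSupport η ∧
      tsupport η ⊆ Ioo 0 l ∧ ∫ x in Ioo 0 l, η x = 1 := by
    let β : ContDiffBump (l / 2) := ⟨l / 8, l / 4, by linarith, by linarith⟩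
    have hsupp : tsupport (β.normed volume) ⊆ Ioo 0 l := by
      rw [β.tsupport_normed_eq, Real.closedBall_eq_Icc]
      apply Icc_subset_Ioo <;> simp only [β] <;> linarith
    refine ⟨β.normed volume, β.contDiff_normed, β.hasCompactSupport_normed, hsupp, ?_⟩
    rw [setIntegral_eq_integral_of_forall_compl_eq_zero fun x hx =>
      image_eq_zero_of_notMem_tsupport fun h' => hx (hsupp h')]
    exact β.integral_normed
  refine ⟨∫ x in Ioo 0 l, η x • h x, ?_⟩
  set c : ℂ := ∫ x in Ioo 0 l, η x • h x
  have hconst : IntegrableOn (fun _ : ℝ => c) (Ioo 0 l) := integrableOn_const (by simp)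
  have key := isOpen_Ioo.ae_eq_zero_of_integral_contDiff_smul_eq_zero
    (U := Ioo (0 : ℝ) l) (μ := volume.restrict (Ioo (0 : ℝ) l)) (f := fun x => h x - c)
    ((hh.sub hconst).locallyIntegrable.locallyIntegrableOn _) (by
      intro ψ h1 h2 h3
      -- `ψ` minus its mean times `η` has mean zero, hence is the derivative of a test function.
      set m : ℝ := ∫ x in Ioo 0 l, ψ x with hm
      have hψi : IntegrableOn ψ (Ioo 0 l) := (h1.continuous.integrable_of_hasCompactSupport
        h2).integrableOn
      have hηi : IntegrableOn η (Ioo 0 l) := (hη.continuous.integrable_of_hasCompactSupport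
        hηc).integrableOn
      have hcs : HasCompactSupport fun x => ψ x - m * η x := h2.sub (hηc.mul_left)
      obtain ⟨φ, hφ1, hφ2, hφ3, hφ4⟩ := exists_contDiff_primitive hl
        (ψ := fun x => ψ x - m * η x) (h1.sub (contDiff_const.mul hη)) hcs
        (by
          have h4 : tsupport (fun x => m * η x) ⊆ tsupport η := tsupport_mul_subset_right
          exact (tsupport_sub ψ fun x => m * η x).trans (union_subset h3 (h4.trans hηs)))
        (by
          rw [integral_sub hψi (hηi.const_mul m), integral_const_mul, hη1, ← hm]
          ring)
      have h5 := hφ φ hφ1 hφ2 hφ3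
      rw [hφ4] at h5
      have i1 := integrable_smul_of_hasCompactSupport hh h1.continuous h2
      have i2 := integrable_smul_of_hasCompactSupport hh hη.continuous hηc
      have i3 := integrable_smul_of_hasCompactSupport hconst h1.continuous h2
      have i2' : Integrable (fun x => m • η x • h x) (volume.restrict (Ioo 0 l)) := i2.fun_smul m
      have h6 : ∫ x in Ioo 0 l, ψ x • h x = m • c := by
        have : ∫ x in Ioo 0 l, (ψ x - m * η x) • h x
            = ∫ x in Ioo 0 l, (ψ x • h x - m • (η x • h x)) := by
          simp only [sub_smul, mul_smul]
        rw [this, integral_sub i1 i2', integral_smul] at h5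
        exact sub_eq_zero.1 h5
      simp only [smul_sub]
      rw [integral_sub i1 i3, h6, integral_smul_const, ← hm, sub_self])
  filter_upwards [key, ae_restrict_mem measurableSet_Ioo] with x hx hm
  exact sub_eq_zero.1 (hx hm)

/-- A continuous function whose distributional derivative is an integrable function `g` that is
continuous on the open interval is differentiable there, with derivative `g`. -/
lemma hasDerivAt_of_integral_deriv_smul_eq {l : ℝ} (hl : 0 < l) {u g : ℝ → ℂ}
    (hu : ContinuousOn u (Icc 0 l)) (hg : ContinuousOn g (Ioo 0 l))
    (hgi : IntegrableOn g (Ioo 0 l))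
    (hφ : ∀ φ : ℝ → ℝ, ContDiff ℝ ∞ φ → HasCompactSupport φ → tsupport φ ⊆ Ioo 0 l →
      ∫ x in Ioo 0 l, deriv φ x • u x = - ∫ x in Ioo 0 l, φ x • g x) :
    ∀ x ∈ Ioo 0 l, HasDerivAt u (g x) x := by
  have hgii : IntervalIntegrable g volume 0 l := by
    rwa [intervalIntegrable_iff_integrableOn_Ioo_of_le hl.le]
  set P : ℝ → ℂ := fun x => ∫ t in (0 : ℝ)..x, g t
  have hPc : ContinuousOn P (Icc 0 l) := by
    have := intervalIntegral.continuousOn_primitive_interval' (a := 0) hgii left_mem_uIcc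
    rwa [uIcc_of_le hl.le] at this
  have hPd : ∀ x ∈ Ioo 0 l, HasDerivAt P (g x) x := by
    intro x hx
    refine intervalIntegral.integral_hasDerivAt_right (hgii.mono_set ?_)
      (hg.stronglyMeasurableAtFilter isOpen_Ioo x hx) (hg.continuousAt (isOpen_Ioo.mem_nhds hx))
    rw [uIcc_of_le hl.le, uIcc_of_le hx.1.le]
    exact Icc_subset_Icc_right hx.2.le
  have hui : IntegrableOn u (Ioo 0 l) := (hu.integrableOn_Icc).mono_set Ioo_subset_Icc_self
  have hPi : IntegrableOn P (Ioo 0 l) := (hPc.integrableOn_Icc).mono_set Ioo_subset_Icc_self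
  have hP : ∀ φ : ℝ → ℝ, ContDiff ℝ ∞ φ → HasCompactSupport φ → tsupport φ ⊆ Ioo 0 l →
      ∫ x in Ioo 0 l, deriv φ x • P x = - ∫ x in Ioo 0 l, φ x • g x := by
    intro φ h1 h2 h3
    have hd : Continuous (deriv φ) := h1.continuous_deriv (by simp)
    have i1 := integrable_smul_of_hasCompactSupport hPi hd h2.deriv
    have i2 := integrable_smul_of_hasCompactSupport hgi h1.continuous h2
    have hz : ∀ x, x ∉ Ioo 0 l → φ x = 0 := fun x hx => image_eq_zero_of_notMem_tsupport
      fun h => hx (h3 h)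
    have h4 := intervalIntegral.integral_eq_sub_of_hasDerivAt_of_le (f := fun x => φ x • P x)
      (f' := fun x => φ x • g x + deriv φ x • P x) hl.le
      (h1.continuous.continuousOn.smul hPc)
      (fun x hx => ((h1.differentiable (by simp) x).hasDerivAt).smul (hPd x hx))
      (by rw [intervalIntegrable_iff_integrableOn_Ioo_of_le hl.le]; exact i2.add i1)
    rw [hz 0 (by simp), hz l (by simp), intervalIntegral.integral_of_le hl.le,
      integral_Ioc_eq_integral_Ioo, integral_add i2 i1] at h4
    simp only [zero_smul, sub_zero] at h4
    exact eq_neg_of_add_eq_zero_right h4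
  obtain ⟨c, hc⟩ := ae_eq_const_of_integral_deriv_smul_eq_zero hl (h := fun x => u x - P x)
    (hui.sub hPi) (by
      intro φ h1 h2 h3
      have hd : Continuous (deriv φ) := h1.continuous_deriv (by simp)
      simp only [smul_sub]
      rw [integral_sub (integrable_smul_of_hasCompactSupport hui hd h2.deriv)
        (integrable_smul_of_hasCompactSupport hPi hd h2.deriv), hφ φ h1 h2 h3, hP φ h1 h2 h3,
        sub_self])
  have heq := Measure.eqOn_open_of_ae_eq hc isOpen_Ioo
    ((hu.sub hPc).mono Ioo_subset_Icc_self) continuousOn_const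
  intro x hx
  refine ((hPd x hx).add_const c).congr_of_eventuallyEq ?_
  filter_upwards [isOpen_Ioo.mem_nhds hx] with y hy
  have h' : u y - P y = c := heq hy
  rw [← h']
  ring

/-- Continuous representatives of `f` and of its weak derivative are related by classical
differentiation. -/
lemma HasWeakDeriv.hasDerivAt {l : ℝ} (hl : 0 < l) {f g : EdgeL2 l} (h : HasWeakDeriv f g)
    {u w : ℝ → ℂ} (hu : ContinuousOn u (Icc 0 l)) (hfu : f =ᵐ[volume.restrict (Ioo 0 l)] u)
    (hw : ContinuousOn w (Ioo 0 l)) (hgw : g =ᵐ[volume.restrict (Ioo 0 l)] w) :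
    ∀ x ∈ Ioo 0 l, HasDerivAt u (w x) x := by
  refine hasDerivAt_of_integral_deriv_smul_eq hl hu hw
    (((Lp.memLp g).integrable (by norm_num)).congr hgw) fun φ h1 h2 h3 => ?_
  have e1 : ∫ x in Ioo 0 l, deriv φ x • u x = ∫ x in Ioo 0 l, deriv φ x • f x :=
    integral_congr_ae (hfu.symm.mono fun x hx => by simp only [hx])
  have e2 : ∫ x in Ioo 0 l, φ x • w x = ∫ x in Ioo 0 l, φ x • g x :=
    integral_congr_ae (hgw.symm.mono fun x hx => by simp only [hx])
  rw [e1, e2, h φ h1 h2 h3]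

/-- The continuous representatives provided by the two ends of an edge agree, so that a single one
takes both boundary values. -/
lemma HasValueAt.exists_common {l : ℝ} (hl : 0 < l) {f : EdgeL2 l} {a b : ℂ}
    (h0 : HasValueAt f 0 a) (h1 : HasValueAt f l b) :
    ∃ u : ℝ → ℂ, ContinuousOn u (Icc 0 l) ∧ f =ᵐ[volume.restrict (Ioo 0 l)] u ∧
      u 0 = a ∧ u l = b := by
  obtain ⟨u, hu, hfu, rfl⟩ := h0
  obtain ⟨w, hw, hfw, rfl⟩ := h1
  refine ⟨u, hu, hfu, rfl, ?_⟩
  have h := Measure.eqOn_Icc_of_ae_eq (μ := volume) hl.ne (f := u) (g := w)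
    (by rw [restrict_Ioo_eq_restrict_Icc.symm]; exact hfu.symm.trans hfw) hu hw
  exact h (right_mem_Icc.2 hl.le)

/-! ### Estimates for classical solutions on an edge -/

/-- `u` is a classical solution, with derivative `w`, of `-u'' + q u = lam u` on `(0, l)`, and both
`u` and `w` extend continuously to `[0, l]`. -/
structure IsEdgeSolution (l : ℝ) (q : ℝ → ℝ) (lam : ℝ) (u w : ℝ → ℂ) : Prop where
  continuousOn : ContinuousOn u (Icc 0 l)
  continuousOn_deriv : ContinuousOn w (Icc 0 l)
  hasDerivAt : ∀ x ∈ Ioo 0 l, HasDerivAt u (w x) x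
  hasDerivAt_deriv : ∀ x ∈ Ioo 0 l, HasDerivAt w (((q x - lam : ℝ) : ℂ) * u x) x

lemma le_add_integral_of_abs_deriv_le {l : ℝ} {F F' φ : ℝ → ℝ} (hF : ContinuousOn F (Icc 0 l))
    (hφ : ContinuousOn φ (Icc 0 l)) (hφ0 : ∀ x, 0 ≤ φ x)
    (hd : ∀ x ∈ Ioo 0 l, HasDerivAt F (F' x) x) (hb : ∀ x ∈ Ioo 0 l, |F' x| ≤ φ x)
    {x y : ℝ} (hx : x ∈ Icc 0 l) (hy : y ∈ Icc 0 l) :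
    F x ≤ F y + ∫ t in (0 : ℝ)..l, φ t := by
  have hl : 0 ≤ l := hx.1.trans hx.2
  have hi : IntervalIntegrable φ volume 0 l := hφ.intervalIntegrable_of_Icc hl
  have mono : ∀ {a b : ℝ}, a ∈ Icc 0 l → b ∈ Icc 0 l → a ≤ b →
      ∫ t in a..b, φ t ≤ ∫ t in (0 : ℝ)..l, φ t := fun ha hb hab =>
    intervalIntegral.integral_mono_interval ha.1 hab hb.2 (Filter.Eventually.of_forall hφ0) hi
  rcases le_total y x with h | h
  · have h1 := intervalIntegral.sub_le_integral_of_hasDeriv_right_of_le (g := F) (g' := F')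
      (φ := φ) h (hF.mono (Icc_subset_Icc hy.1 hx.2))
      (fun t ht => (hd t ⟨hy.1.trans_lt ht.1, ht.2.trans_le hx.2⟩).hasDerivWithinAt)
      (hφ.mono (Icc_subset_Icc hy.1 hx.2)).integrableOn_Icc
      (fun t ht => (abs_le.1 (hb t ⟨hy.1.trans_lt ht.1, ht.2.trans_le hx.2⟩)).2)
    linarith [mono hy hx h]
  · have h1 := intervalIntegral.integral_le_sub_of_hasDeriv_right_of_le (g := F) (g' := F')
      (φ := fun t => -φ t) h (hF.mono (Icc_subset_Icc hx.1 hy.2))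
      (fun t ht => (hd t ⟨hx.1.trans_lt ht.1, ht.2.trans_le hy.2⟩).hasDerivWithinAt)
      (hφ.mono (Icc_subset_Icc hx.1 hy.2)).neg.integrableOn_Icc
      (fun t ht => (abs_le.1 (hb t ⟨hx.1.trans_lt ht.1, ht.2.trans_le hy.2⟩)).1)
    rw [intervalIntegral.integral_neg] at h1
    linarith [mono hx hy h]

/-- A Grönwall inequality in both directions: a function whose logarithmic derivative is bounded
by `K` has comparable values at any two points of `[0, l]`. -/
lemma le_exp_mul_of_abs_deriv_le {l K : ℝ} (hK : 0 ≤ K) {F F' : ℝ → ℝ}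
    (hF : ContinuousOn F (Icc 0 l)) (hF0 : ∀ x, 0 ≤ F x)
    (hd : ∀ x ∈ Ioo 0 l, HasDerivAt F (F' x) x) (hb : ∀ x ∈ Ioo 0 l, |F' x| ≤ K * F x)
    {x y : ℝ} (hx : x ∈ Icc 0 l) (hy : y ∈ Icc 0 l) :
    F x ≤ Real.exp (K * l) * F y := by
  have hexp : ∀ c t : ℝ, HasDerivAt (fun s => Real.exp (c * s)) (Real.exp (c * t) * c) t := by
    intro c t
    simpa using ((hasDerivAt_id t).const_mul c).exp
  have hcont : ∀ c : ℝ, ContinuousOn (fun s => Real.exp (c * s) * F s) (Icc 0 l) := fun c =>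
    (by fun_prop : Continuous fun s => Real.exp (c * s)).continuousOn.mul hF
  have hder : ∀ c : ℝ, ∀ t ∈ Ioo 0 l, HasDerivAt (fun s => Real.exp (c * s) * F s)
      (Real.exp (c * t) * (c * F t + F' t)) t := by
    intro c t ht
    convert! (hexp c t).mul (hd t ht) using 1
    ring
  have hdist : ∀ {a b : ℝ}, a ∈ Icc 0 l → b ∈ Icc 0 l →
      Real.exp (K * (a - b)) ≤ Real.exp (K * l) := fun ha hb =>
    Real.exp_le_exp.2 (mul_le_mul_of_nonneg_left (by linarith [ha.2, hb.1]) hK)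
  rcases le_total x y with h | h
  · have hm : MonotoneOn (fun s => Real.exp (K * s) * F s) (Icc 0 l) := by
      refine monotoneOn_of_deriv_nonneg (convex_Icc _ _) (hcont K) ?_ ?_
      · rw [interior_Icc]
        exact fun t ht => (hder K t ht).differentiableAt.differentiableWithinAt
      · rw [interior_Icc]
        intro t ht
        rw [(hder K t ht).deriv]
        exact mul_nonneg (Real.exp_pos _).le (by linarith [(abs_le.1 (hb t ht)).1])
    have h1 : Real.exp (K * x) * F x ≤ Real.exp (K * y) * F y := hm hx hy h
    have h2 : F x ≤ Real.exp (K * (y - x)) * F y := by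
      rw [mul_sub, Real.exp_sub, div_mul_eq_mul_div, le_div_iff₀ (Real.exp_pos _)]
      linarith
    exact h2.trans (mul_le_mul_of_nonneg_right (hdist hy hx) (hF0 y))
  · have hm : AntitoneOn (fun s => Real.exp (-K * s) * F s) (Icc 0 l) := by
      refine antitoneOn_of_deriv_nonpos (convex_Icc _ _) (hcont (-K)) ?_ ?_
      · rw [interior_Icc]
        exact fun t ht => (hder (-K) t ht).differentiableAt.differentiableWithinAt
      · rw [interior_Icc]
        intro t ht
        rw [(hder (-K) t ht).deriv]
        exact mul_nonpos_of_nonneg_of_nonpos (Real.exp_pos _).le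
          (by linarith [(abs_le.1 (hb t ht)).2])
    have h1 : Real.exp (-K * x) * F x ≤ Real.exp (-K * y) * F y := hm hy hx h
    have h2 : F x ≤ Real.exp (K * (x - y)) * F y := by
      rw [show K * (x - y) = -K * y - -K * x by ring, Real.exp_sub, div_mul_eq_mul_div,
        le_div_iff₀ (Real.exp_pos _)]
      linarith
    exact h2.trans (mul_le_mul_of_nonneg_right (hdist hx hy) (hF0 y))

lemma mul_le_integral_of_forall_le {l c : ℝ} (hl : 0 ≤ l) {φ : ℝ → ℝ}
    (hφ : ContinuousOn φ (Icc 0 l)) (h : ∀ y ∈ Icc 0 l, c ≤ φ y) :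
    l * c ≤ ∫ t in (0 : ℝ)..l, φ t := by
  have := intervalIntegral.integral_mono_on (μ := volume) hl intervalIntegrable_const
    (hφ.intervalIntegrable_of_Icc hl) h
  simpa using this

namespace IsEdgeSolution

variable {l lam : ℝ} {q : ℝ → ℝ} {u w : ℝ → ℂ}

lemma continuousOn_norm_sq (h : IsEdgeSolution l q lam u w) :
    ContinuousOn (fun x => ‖u x‖ ^ 2) (Icc 0 l) := h.continuousOn.norm.pow 2

lemma continuousOn_deriv_norm_sq (h : IsEdgeSolution l q lam u w) :
    ContinuousOn (fun x => ‖w x‖ ^ 2) (Icc 0 l) := h.continuousOn_deriv.norm.pow 2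

/-- The trace inequality: point values are controlled by the `L²` norm and an arbitrarily small
multiple of the `L²` norm of the derivative. -/
lemma norm_sq_le (h : IsEdgeSolution l q lam u w) (hl : 0 < l) {ε : ℝ} (hε : 0 < ε) {x : ℝ}
    (hx : x ∈ Icc 0 l) :
    ‖u x‖ ^ 2 ≤ (1 / l + 1 / ε) * (∫ t in (0 : ℝ)..l, ‖u t‖ ^ 2)
      + ε * ∫ t in (0 : ℝ)..l, ‖w t‖ ^ 2 := by
  have hcu := h.continuousOn_norm_sq
  have hcw := h.continuousOn_deriv_norm_sq
  set N : ℝ := ∫ t in (0 : ℝ)..l, (ε * ‖w t‖ ^ 2 + 1 / ε * ‖u t‖ ^ 2) with hN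
  have key : ∀ y ∈ Icc 0 l, ‖u x‖ ^ 2 - N ≤ ‖u y‖ ^ 2 := by
    intro y hy
    rw [sub_le_iff_le_add]
    refine le_add_integral_of_abs_deriv_le (F := fun x => ‖u x‖ ^ 2)
      (F' := fun x => 2 * inner ℝ (u x) (w x))
      (φ := fun t => ε * ‖w t‖ ^ 2 + 1 / ε * ‖u t‖ ^ 2) hcu
      ((hcw.const_mul ε).add (hcu.const_mul (1 / ε)))
      (fun x => by positivity) (fun t ht => (h.hasDerivAt t ht).norm_sq) (fun t _ => ?_) hx hy
    rw [abs_mul, abs_two]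
    have h1 : |inner ℝ (u t) (w t)| ≤ ‖u t‖ * ‖w t‖ := abs_real_inner_le_norm _ _
    have h2 : ε * ‖w t‖ ^ 2 + 1 / ε * ‖u t‖ ^ 2 - 2 * (‖u t‖ * ‖w t‖)
        = 1 / ε * (ε * ‖w t‖ - ‖u t‖) ^ 2 := by
      field_simp
      ring
    have h3 : 0 ≤ 1 / ε * (ε * ‖w t‖ - ‖u t‖) ^ 2 := by positivity
    linarith
  have h1 := mul_le_integral_of_forall_le hl.le hcu key
  have iw := hcw.intervalIntegrable_of_Icc (μ := volume) hl.le
  have iu := hcu.intervalIntegrable_of_Icc (μ := volume) hl.le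
  rw [intervalIntegral.integral_add (iw.const_mul ε) (iu.const_mul (1 / ε)),
    intervalIntegral.integral_const_mul, intervalIntegral.integral_const_mul] at hN
  rw [mul_comm, ← le_div_iff₀ hl] at h1
  have h2 : (∫ t in (0 : ℝ)..l, ‖u t‖ ^ 2) / l = 1 / l * ∫ t in (0 : ℝ)..l, ‖u t‖ ^ 2 := by ring
  rw [h2] at h1
  linarith

/-- The energy inequality on an edge, obtained by testing the equation with `u` and integrating by
parts. -/
lemma integral_norm_sq_deriv_le (h : IsEdgeSolution l q lam u w) (hl : 0 < l) {M : ℝ}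
    (hq : ∀ x ∈ Ioo 0 l, |q x| ≤ M) :
    ∫ t in (0 : ℝ)..l, ‖w t‖ ^ 2 ≤ (M + lam) * (∫ t in (0 : ℝ)..l, ‖u t‖ ^ 2)
      + (inner ℝ (w l) (u l) - inner ℝ (w 0) (u 0)) := by
  have hcu := h.continuousOn_norm_sq
  have hcw := h.continuousOn_deriv_norm_sq
  have iw := hcw.intervalIntegrable_of_Icc (μ := volume) hl.le
  have iu := hcu.intervalIntegrable_of_Icc (μ := volume) hl.le
  have h1 := intervalIntegral.integral_le_sub_of_hasDeriv_right_of_le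
    (g := fun x => inner ℝ (w x) (u x))
    (g' := fun x => inner ℝ (w x) (w x) + inner ℝ (((q x - lam : ℝ) : ℂ) * u x) (u x))
    (φ := fun x => ‖w x‖ ^ 2 - (M + lam) * ‖u x‖ ^ 2) hl.le
    (h.continuousOn_deriv.inner h.continuousOn)
    (fun x hx => ((h.hasDerivAt_deriv x hx).inner ℝ (h.hasDerivAt x hx)).hasDerivWithinAt)
    (hcw.sub (hcu.const_mul _)).integrableOn_Icc
    -- No integrability of `q` is needed: only the lower bound `-M` enters.
    (fun x hx => by
      rw [← Complex.real_smul, real_inner_smul_left, real_inner_self_eq_norm_sq,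
        real_inner_self_eq_norm_sq]
      have := mul_le_mul_of_nonneg_right (abs_le.1 (hq x hx)).1 (sq_nonneg ‖u x‖)
      linarith)
  rw [intervalIntegral.integral_sub iw (iu.const_mul _),
    intervalIntegral.integral_const_mul] at h1
  linarith

/-- The pointwise energy `‖u'‖² + μ ‖u‖²` has logarithmic derivative at most `K` as soon as the
coefficient in `u'' = (q - lam) u` differs from `-μ` by at most `K`, so its value at a point is
controlled by its mean. -/
lemma mul_norm_sq_le (h : IsEdgeSolution l q lam u w) (hl : 0 < l) {μ K : ℝ} (hμ : 1 ≤ μ)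
    (hK : ∀ x ∈ Ioo 0 l, |q x - lam + μ| ≤ K) {x : ℝ} (hx : x ∈ Icc 0 l) :
    l * (μ * ‖u x‖ ^ 2) ≤ Real.exp (K * l) *
      ((∫ t in (0 : ℝ)..l, ‖w t‖ ^ 2) + μ * ∫ t in (0 : ℝ)..l, ‖u t‖ ^ 2) := by
  have hcu := h.continuousOn_norm_sq
  have hcw := h.continuousOn_deriv_norm_sq
  have iw := hcw.intervalIntegrable_of_Icc (μ := volume) hl.le
  have iu := hcu.intervalIntegrable_of_Icc (μ := volume) hl.le
  have hμ0 : 0 ≤ μ := zero_le_one.trans hμ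
  have hK0 : 0 ≤ K := (abs_nonneg _).trans (hK (l / 2) ⟨by linarith, by linarith⟩)
  have key : ∀ y ∈ Icc 0 l, μ * ‖u x‖ ^ 2 ≤ Real.exp (K * l) * (‖w y‖ ^ 2 + μ * ‖u y‖ ^ 2) := by
    intro y hy
    have h1 := le_exp_mul_of_abs_deriv_le (F := fun x => ‖w x‖ ^ 2 + μ * ‖u x‖ ^ 2)
      (F' := fun x => 2 * inner ℝ (w x) (((q x - lam : ℝ) : ℂ) * u x)
        + μ * (2 * inner ℝ (u x) (w x))) hK0 (hcw.add (hcu.const_mul μ))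
      (fun x => by positivity)
      (fun t ht => (h.hasDerivAt_deriv t ht).norm_sq.add
        ((h.hasDerivAt t ht).norm_sq.const_mul μ))
      (fun t ht => by
        rw [← Complex.real_smul, real_inner_smul_right, real_inner_comm (w t) (u t),
          show 2 * ((q t - lam) * inner ℝ (w t) (u t)) + μ * (2 * inner ℝ (w t) (u t))
            = (q t - lam + μ) * (2 * inner ℝ (w t) (u t)) by ring, abs_mul]
        refine mul_le_mul (hK t ht) ?_ (abs_nonneg _) hK0
        rw [abs_mul, abs_two]
        have h2 : |inner ℝ (w t) (u t)| ≤ ‖w t‖ * ‖u t‖ := abs_real_inner_le_norm _ _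
        nlinarith [sq_nonneg (‖w t‖ - ‖u t‖), mul_le_mul_of_nonneg_right hμ (sq_nonneg ‖u t‖)])
      hx hy
    exact (le_add_of_nonneg_left (sq_nonneg _)).trans h1
  have h3 := mul_le_integral_of_forall_le hl.le
    (φ := fun y => Real.exp (K * l) * (‖w y‖ ^ 2 + μ * ‖u y‖ ^ 2))
    ((hcw.add (hcu.const_mul μ)).const_mul (Real.exp (K * l))) key
  rwa [intervalIntegral.integral_const_mul, intervalIntegral.integral_add iw (iu.const_mul μ),
    intervalIntegral.integral_const_mul] at h3

end IsEdgeSolution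

/-! ### Energy balance on the graph and the uniform bound -/

lemma norm_sq_eq_integral {l : ℝ} (hl : 0 < l) {f : EdgeL2 l} {u : ℝ → ℂ}
    (hfu : f =ᵐ[volume.restrict (Ioo 0 l)] u) :
    ‖f‖ ^ 2 = ∫ t in (0 : ℝ)..l, ‖u t‖ ^ 2 := by
  have h1 : ‖f‖ ^ 2 = RCLike.re (inner ℂ f f) := norm_sq_eq_re_inner f
  rw [h1, L2.inner_def, intervalIntegral.integral_of_le hl.le, integral_Ioc_eq_integral_Ioo]
  have h2 : ∫ t in Ioo 0 l, inner ℂ (f t) (f t) = ∫ t in Ioo 0 l, ((‖u t‖ ^ 2 : ℝ) : ℂ) := by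
    refine integral_congr_ae (hfu.mono fun t ht => ?_)
    simp only [ht, inner_self_eq_norm_sq_to_K]
    norm_cast
  rw [h2, integral_complex_ofReal]
  exact RCLike.ofReal_re _

section Graph

variable {V E : Type*}

/-- On every edge a function in the domain that satisfies the eigenvalue equation is represented by
a classical solution with the prescribed boundary values. -/
lemma exists_isEdgeSolution {G : MetricGraph V E} (Q : Potential G) {e : E} {lam : ℝ}
    {f : EdgeL2 (G.len e)} (hf : MemH2 f) {c d a b : ℂ} (hc : HasValueAt f 0 c)
    (hd : HasValueAt f (G.len e) d) (ha : HasValueAt (weakDeriv f) 0 a)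
    (hb : HasValueAt (weakDeriv f) (G.len e) b)
    (heq : - weakDeriv (weakDeriv f) + Q.mulEdge e f = (lam : ℂ) • f) :
    ∃ u w : ℝ → ℂ, IsEdgeSolution (G.len e) (Q.val e) lam u w ∧
      f =ᵐ[volume.restrict (Ioo 0 (G.len e))] u ∧
      u 0 = c ∧ u (G.len e) = d ∧ w 0 = a ∧ w (G.len e) = b := by
  have hl := G.len_pos e
  obtain ⟨u, hu, hfu, hu0, hul⟩ := hc.exists_common hl hd
  obtain ⟨w, hw, hfw, hw0, hwl⟩ := ha.exists_common hl hb
  have h2 : weakDeriv (weakDeriv f) = Q.mulEdge e f - (lam : ℂ) • f := by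
    rw [← heq]
    abel
  have h3 : weakDeriv (weakDeriv f) =ᵐ[volume.restrict (Ioo 0 (G.len e))]
      fun x => ((Q.val e x - lam : ℝ) : ℂ) * u x := by
    rw [h2]
    filter_upwards [Lp.coeFn_sub (Q.mulEdge e f) ((lam : ℂ) • f), (Q.memLp_mul e f).coeFn_toLp,
      Lp.coeFn_smul (lam : ℂ) f, hfu] with x h4 h5 h6 h7
    have h8 : (Q.mulEdge e f) x = (Q.val e x : ℂ) * f x := h5
    rw [h4, Pi.sub_apply, h8, h6, Pi.smul_apply, h7, smul_eq_mul]
    push_cast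
    ring
  have hcont : ContinuousOn (fun x => ((Q.val e x - lam : ℝ) : ℂ) * u x) (Ioo 0 (G.len e)) :=
    (Complex.continuous_ofReal.comp_continuousOn
      ((Q.smooth e).continuousOn.sub continuousOn_const)).mul (hu.mono Ioo_subset_Icc_self)
  exact ⟨u, w, ⟨hu, hw, (hasWeakDeriv_weakDeriv hf.1).hasDerivAt hl hu hfu
      (hw.mono Ioo_subset_Icc_self) hfw,
    (hasWeakDeriv_weakDeriv hf.2).hasDerivAt hl hw hfw hcont h3⟩, hfu, hu0, hul, hw0, hwl⟩

variable [Fintype V] [Fintype E]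

/-- The boundary terms of all the edges, regrouped by vertices. -/
lemma sum_inner_inwardDerivSum (G : MetricGraph V E) (a b : E → ℂ) (F : V → ℂ) :
    ∑ v, inner ℝ (inwardDerivSum G a b v) (F v)
      = ∑ e, (inner ℝ (a e) (F (G.src e)) - inner ℝ (b e) (F (G.tgt e))) := by
  classical
  simp only [inwardDerivSum, sum_inner]
  rw [Finset.sum_comm]
  refine Finset.sum_congr rfl fun e _ => ?_
  have h : ∀ (v₀ : V) (z : ℂ), ∑ v, inner ℝ (if v₀ = v then z else 0) (F v)
      = inner ℝ z (F v₀) := by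
    intro v₀ z
    rw [Finset.sum_eq_single v₀ (fun v _ hv => by rw [if_neg hv.symm, inner_zero_left])
      (fun h => absurd (Finset.mem_univ _) h), if_pos rfl]
  simp only [inner_add_left, Finset.sum_add_distrib]
  have h1 := h (G.src e) (a e)
  have h2 := h (G.tgt e) (-b e)
  rw [inner_neg_left] at h2
  rw [sub_eq_add_neg, ← h1, ← h2]

/-- The `δ`-couplings contribute to the energy at most the total coupling strength times a bound for
the squared boundary values. A vertex with no incident edge contributes nothing, since the vertex
condition forces `s v * F v = 0` there. -/
lemma neg_sum_inner_inwardDerivSum_le (G : MetricGraph V E) {a b : E → ℂ} {F : V → ℂ} {s : V → ℝ}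
    (hs : ∀ v, inwardDerivSum G a b v = (s v : ℂ) * F v) {B : ℝ} (hB : 0 ≤ B)
    (hsrc : ∀ e, ‖F (G.src e)‖ ^ 2 ≤ B) (htgt : ∀ e, ‖F (G.tgt e)‖ ^ 2 ≤ B) :
    - ∑ v, inner ℝ (inwardDerivSum G a b v) (F v) ≤ (∑ v, |s v|) * B := by
  rw [← Finset.sum_neg_distrib, Finset.sum_mul]
  refine Finset.sum_le_sum fun v _ => ?_
  by_cases hv : ∃ e, G.src e = v ∨ G.tgt e = v
  · have hFv : ‖F v‖ ^ 2 ≤ B := by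
      obtain ⟨e, rfl | rfl⟩ := hv
      exacts [hsrc e, htgt e]
    rw [hs, ← Complex.real_smul, real_inner_smul_left, real_inner_self_eq_norm_sq, ← neg_mul]
    exact mul_le_mul (neg_le_abs _) hFv (sq_nonneg _) (abs_nonneg _)
  · push Not at hv
    have h0 : inwardDerivSum G a b v = 0 :=
      Finset.sum_eq_zero fun e _ => by rw [if_neg (hv e).1, if_neg (hv e).2, add_zero]
    rw [h0, inner_zero_left, neg_zero]
    positivity

/-- The uniform bound, with a constant that depends on the graph, on a bound `M` for the potential
and on a bound `S` for the total coupling strength only. -/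
theorem exists_linftyNorm_le (G : MetricGraph V E) {M S : ℝ} (hM : 0 ≤ M) (hS : 0 ≤ S) :
    ∃ C : ℝ, 0 < C ∧ ∀ (Q : Potential G) (s : V → ℝ) (lam : ℝ) (f : L2 G),
      (∀ e, ∀ x ∈ Ioo 0 (G.len e), |Q.val e x| ≤ M) → ∑ v, |s v| ≤ S →
      IsNormalizedEigenfunction (schrodinger G Q s) lam f →
        linftyNorm G f ≤ ENNReal.ofReal C := by
  have hlp := G.len_pos
  set L : ℝ := ∑ e, 1 / G.len e
  have hL : 0 ≤ L := Finset.sum_nonneg fun e _ => (one_div_pos.2 (hlp e)).le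
  -- `D` is the bound for `-lam`, and `K` the bound for the logarithmic derivative of the energy.
  set D : ℝ := M + S * (L + 2 * (S + 1))
  have hD : 0 ≤ D := by positivity
  set K : ℝ := M + (1 + D)
  have hterm : ∀ e, 0 ≤ Real.exp (K * G.len e) * (3 + 2 * D) / G.len e := fun e =>
    div_nonneg (by positivity) (hlp e).le
  set A : ℝ := 1 + ∑ e, Real.exp (K * G.len e) * (3 + 2 * D) / G.len e
  have hA : 1 ≤ A := le_add_of_nonneg_right (Finset.sum_nonneg fun e _ => hterm e)
  refine ⟨A, by linarith, ?_⟩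
  rintro Q s lam f hQ hs ⟨hnorm, ⟨hH2, F, hF, a, b, hab, hv⟩, heig⟩
  have hsol : ∀ e, ∃ u w : ℝ → ℂ, IsEdgeSolution (G.len e) (Q.val e) lam u w ∧
      f e =ᵐ[volume.restrict (Ioo 0 (G.len e))] u ∧
      u 0 = F (G.src e) ∧ u (G.len e) = F (G.tgt e) ∧ w 0 = a e ∧ w (G.len e) = b e := fun e =>
    exists_isEdgeSolution Q (hH2 e) (hF e).1 (hF e).2 (hab e).1 (hab e).2
      (congrArg (fun g : L2 G => g e) heig)
  choose u w hsol hfu hu0 hul hw0 hwl using hsol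
  set P : E → ℝ := fun e => ∫ t in (0 : ℝ)..G.len e, ‖u e t‖ ^ 2
  set W : E → ℝ := fun e => ∫ t in (0 : ℝ)..G.len e, ‖w e t‖ ^ 2
  have hP0 : ∀ e, 0 ≤ P e := fun e =>
    intervalIntegral.integral_nonneg (hlp e).le fun _ _ => sq_nonneg _
  have hW0 : ∀ e, 0 ≤ W e := fun e =>
    intervalIntegral.integral_nonneg (hlp e).le fun _ _ => sq_nonneg _
  have hP : ∑ e, P e = 1 := by
    have h := PiLp.norm_sq_eq_of_L2 _ f
    rw [hnorm, one_pow] at h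
    rw [h]
    exact Finset.sum_congr rfl fun e _ => (norm_sq_eq_integral (hlp e) (hfu e)).symm
  have hPle : ∀ e, P e ≤ 1 := fun e =>
    (Finset.single_le_sum (fun e _ => hP0 e) (Finset.mem_univ e)).trans hP.le
  set T : ℝ := ∑ e, W e
  have hT : 0 ≤ T := Finset.sum_nonneg fun e _ => hW0 e
  have hWle : ∀ e, W e ≤ T := fun e =>
    Finset.single_le_sum (fun e _ => hW0 e) (Finset.mem_univ e)
  have hLle : ∀ e, 1 / G.len e ≤ L := fun e =>
    Finset.single_le_sum (f := fun e => 1 / G.len e) (fun e _ => (one_div_pos.2 (hlp e)).le)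
      (Finset.mem_univ e)
  -- The parameter in the trace inequality is chosen so that the couplings absorb at most half of
  -- the kinetic energy.
  set ε : ℝ := 1 / (2 * (S + 1)) with hε
  have hε0 : 0 < ε := by positivity
  have hε1 : 1 / ε = 2 * (S + 1) := by rw [hε, one_div_one_div]
  have hSε : S * ε ≤ 1 / 2 := by
    rw [hε, mul_one_div, div_le_iff₀ (by positivity)]
    linarith
  set B : ℝ := L + 2 * (S + 1) + ε * T
  have hB : 0 ≤ B := by positivity
  have hbound : ∀ e, ∀ x ∈ Icc 0 (G.len e), ‖u e x‖ ^ 2 ≤ B := by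
    intro e x hx
    refine ((hsol e).norm_sq_le (hlp e) hε0 hx).trans (add_le_add ?_
      (mul_le_mul_of_nonneg_left (hWle e) hε0.le))
    rw [hε1]
    have h1 : 0 < 1 / G.len e := one_div_pos.2 (hlp e)
    exact (mul_le_of_le_one_right (by positivity) (hPle e)).trans
      (add_le_add_left (hLle e) _)
  have hvert := neg_sum_inner_inwardDerivSum_le G hv hB
    (fun e => hu0 e ▸ hbound e 0 (left_mem_Icc.2 (hlp e).le))
    (fun e => hul e ▸ hbound e _ (right_mem_Icc.2 (hlp e).le))
  have henergy : T ≤ (M + lam) + (∑ v, |s v|) * B := by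
    have h1 : T ≤ ∑ e, ((M + lam) * P e
        + (inner ℝ (b e) (F (G.tgt e)) - inner ℝ (a e) (F (G.src e)))) := by
      refine Finset.sum_le_sum fun e _ => ?_
      have h2 := (hsol e).integral_norm_sq_deriv_le (hlp e) (hQ e)
      rwa [hu0, hul, hw0, hwl] at h2
    have h3 : ∑ e, (inner ℝ (b e) (F (G.tgt e)) - inner ℝ (a e) (F (G.src e)))
        = - ∑ v, inner ℝ (inwardDerivSum G a b v) (F v) := by
      rw [sum_inner_inwardDerivSum, ← Finset.sum_neg_distrib]
      exact Finset.sum_congr rfl fun e _ => (neg_sub _ _).symm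
    rw [Finset.sum_add_distrib, ← Finset.mul_sum, hP, mul_one, h3] at h1
    linarith
  have hTle : T ≤ 2 * (lam + D) := by
    have h1 : (∑ v, |s v|) * B ≤ S * B := mul_le_mul_of_nonneg_right hs hB
    have h2 : S * ε * T ≤ 1 / 2 * T := mul_le_mul_of_nonneg_right hSε hT
    have h3 : S * B = S * (L + 2 * (S + 1)) + S * ε * T := by ring
    have h4 : D = M + S * (L + 2 * (S + 1)) := rfl
    linarith
  have hlam : -D ≤ lam := by linarith
  set μ : ℝ := max lam 1
  have hμ1 : 1 ≤ μ := le_max_right _ _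
  have hμlam : lam ≤ μ := le_max_left _ _
  have hμle : μ - lam ≤ 1 + D := by
    rw [sub_le_iff_le_add]
    exact max_le (by linarith) (by linarith)
  have hpoint : ∀ e, ∀ x ∈ Ioo 0 (G.len e), ‖u e x‖ ≤ A := by
    intro e x hx
    have h1 := (hsol e).mul_norm_sq_le (hlp e) hμ1 (K := K) (fun t ht => by
      have h2 := abs_le.1 (hQ e t ht)
      rw [abs_le]
      constructor <;> linarith [h2.1, h2.2, show K = M + (1 + D) from rfl]) ⟨hx.1.le, hx.2.le⟩
    have h3 : W e + μ * P e ≤ μ * (3 + 2 * D) := by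
      have h4 : μ * P e ≤ μ := mul_le_of_le_one_right (by linarith) (hPle e)
      have h5 : D ≤ μ * D := le_mul_of_one_le_left hD hμ1
      linarith [hWle e]
    have h6 : G.len e * (μ * ‖u e x‖ ^ 2) ≤ Real.exp (K * G.len e) * (μ * (3 + 2 * D)) :=
      h1.trans (mul_le_mul_of_nonneg_left h3 (Real.exp_pos _).le)
    have h7 : ‖u e x‖ ^ 2 ≤ Real.exp (K * G.len e) * (3 + 2 * D) / G.len e := by
      rw [le_div_iff₀ (hlp e)]
      refine le_of_mul_le_mul_left (a := μ) ?_ (by linarith)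
      linarith
    have h8 : Real.exp (K * G.len e) * (3 + 2 * D) / G.len e ≤ A :=
      (Finset.single_le_sum (f := fun e => Real.exp (K * G.len e) * (3 + 2 * D) / G.len e)
        (fun e _ => hterm e) (Finset.mem_univ e)).trans (le_add_of_nonneg_left zero_le_one)
    -- Since `1 ≤ A`, the bound `A` for the square is also a bound for the norm itself.
    refine abs_le_of_sq_le_sq' ?_ (by linarith) |>.2
    exact (h7.trans h8).trans (le_self_pow₀ hA two_ne_zero)
  refine iSup_le fun e => ?_
  rw [eLpNorm_exponent_top]
  refine eLpNormEssSup_le_of_ae_bound ?_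
  filter_upwards [hfu e, ae_restrict_mem measurableSet_Ioo] with x hx hm
  rw [hx]
  exact hpoint e x hm

end Graph

end QuantumGraph

theorem mainTheorem5 {V E : Type*} [Fintype V] [Fintype E]
    (G : QuantumGraph.MetricGraph V E) (U : QuantumGraph.Potential G) (σ : V → ℝ) :
    ∃ C : ℝ, 0 < C ∧ ∀ τ ∈ Set.Icc (0 : ℝ) 1,
      (∀ (lam : ℝ) (f : QuantumGraph.L2 G),
        QuantumGraph.IsNormalizedEigenfunction (QuantumGraph.schrodinger G U (τ • σ)) lam f →
          QuantumGraph.linftyNorm G f ≤ ENNReal.ofReal C) ∧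
      (∀ (lam : ℝ) (f : QuantumGraph.L2 G),
        QuantumGraph.IsNormalizedEigenfunction (QuantumGraph.schrodinger G (τ • U) (τ • σ)) lam f →
          QuantumGraph.linftyNorm G f ≤ ENNReal.ofReal C) := by
  choose m hm using U.bounded
  have hbd : ∀ e, ∀ x ∈ Ioo 0 (G.len e), |U.val e x| ≤ ∑ e, |m e| := fun e x hx =>
    ((hm e x hx).trans (le_abs_self _)).trans
      (Finset.single_le_sum (f := fun e => |m e|) (fun e _ => abs_nonneg _) (Finset.mem_univ e))
  obtain ⟨C, hC, hbound⟩ := QuantumGraph.exists_linftyNorm_le G (M := ∑ e, |m e|)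
    (S := ∑ v, |σ v|) (Finset.sum_nonneg fun e _ => abs_nonneg _)
    (Finset.sum_nonneg fun v _ => abs_nonneg _)
  refine ⟨C, hC, fun τ hτ => ?_⟩
  have hτ1 : |τ| ≤ 1 := abs_le.2 ⟨by linarith [hτ.1], hτ.2⟩
  have hσ : ∑ v, |(τ • σ) v| ≤ ∑ v, |σ v| := by
    refine Finset.sum_le_sum fun v _ => ?_
    rw [Pi.smul_apply, smul_eq_mul, abs_mul]
    exact mul_le_of_le_one_left (abs_nonneg _) hτ1
  refine ⟨fun lam f => hbound U (τ • σ) lam f hbd hσ,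
    fun lam f => hbound (τ • U) (τ • σ) lam f (fun e x hx => ?_) hσ⟩
  change |τ * U.val e x| ≤ _
  rw [abs_mul]
  exact (mul_le_of_le_one_left (abs_nonneg _) hτ1).trans (hbd e x hx)
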